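/- Let $\lambda_1,\lambda_2,\mu_1,\mu_2,c_1,c_2>0$ satisfy $\lambda_1>\mu_1c_1$ and $\mu_1c_1+\mu_2c_2<\lambda_1+\lambda_2$. Put $s=\lambda_1+\lambda_2+\mu_1c_1+\mu_2c_2$ and $$K(x,y)=\mu_1c_1x^2y+\mu_2c_2xy^2-s\,xy+\lambda_1y+\lambda_2x,$$ $$\Delta_1(y)=(\mu_2c_2y^2-sy+\lambda_2)^2-4\mu_1c_1\lambda_1y^2,\qquad \Delta_2(x)=(\mu_1c_1x^2-sx+\lambda_1)^2-4\mu_2c_2\lambda_2x^2.$$ Let $y_1<y_2$ be the two smallest of the four positive roots of $\Delta_1$, and let $x_1<x_2<x_3<x_4$ be the roots of $\Delta_2$. Let $\sigma_2$ be the analytic extension to $\mathbb C\setminus([x_1,x_2]\cup[x_3,x_4])$ of $\sqrt{\Delta_2(x)}$ defined near $0$ (with value $\lambda_1$ at $0$), and let $$Y_0(x)=\frac{-(\mu_1c_1x^2-sx+\lambda_1)+\sigma_2(x)}{2\mu_2c_2x}$$ be the root of $K(x,\cdot)$ that vanishes at $x=0$. Let $r_1=\sqrt{\lambda_1/(\mu_1c_1)}$,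 $D_{r_1}=\{|x|<r_1\}$, $C_{r_1}=\{|x|=r_1\}$, and for $x\in C_{r_1}$ $$\alpha_1(x)=\frac{\bar x\,(Y_0(x)-x)}{x\,(Y_0(x)-\bar x)} .$$ Consider the homogeneous Riemann–Hilbert problem: find $\phi_1$, analytic on $D_{r_1}$ and on $\{|x|>r_1\}$, with an interior limit $\phi_1^i(x)$ and an exterior limit $\phi_1^e(x)$ at every $x\in C_{r_1}$, such that $\phi_1^i(x)=\alpha_1(x)\,\phi_1^e(x)$ for all $x\in C_{r_1}$. Then: 1. The index of the problem is zero: $\alpha_1$ has no zero on $C_{r_1}$ and $\frac1{2\pi}\operatorname{var}_{x\in C_{r_1}}\arg\alpha_1(x)=0$. 2. The problem has a solution $\phi_1$ with $\phi_1(x)\to1$ as $|x|\to\infty$, and every such solution is given for $x\in D_{r_1}$ by $$\phi_1(x)=\exp\left(\frac{x}{\pi}\int_{y_1}^{y_2}\frac{(\lambda_2-\mu_2c_2y^2)\,\Theta_1(y)}{y\,K(x,y)}\,dy\right),$$ where the integral converges absolutely and $$\Theta_1(y)=\arctan\left(\frac{\sqrt{-\Delta_1(y)}}{\mu_2c_2y^2-s\,y+2\lambda_1+\lambda_2}\right).$$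 More generally, every solution that has a finite limit $C$ at infinity equals $C$ times this expression on $D_{r_1}$. -/

import Mathlib

open Filter Topology

/-! ### The parameters of the random walk -/

/-- The positive parameters `λᵢ` (arrival intensities), `μᵢ` (service rates) and `cᵢ` (capacities)
of the two-dimensional random walk. -/
structure WalkParams where
  lam₁ : ℝ
  lam₂ : ℝ
  mu₁ : ℝ
  mu₂ : ℝ
  c₁ : ℝ
  c₂ : ℝ
  lam₁_pos : 0 < lam₁
  lam₂_pos : 0 < lam₂
  mu₁_pos : 0 < mu₁
  mu₂_pos : 0 < mu₂
  c₁_pos : 0 < c₁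
  c₂_pos : 0 < c₂

/-- The smaller root of `a t² - b t + l` (for positive `a` and discriminant). The discriminants of
the kernel have the form `(a t² - s t + l)² - 4 m t²`, and their four roots are those of
`a t² - (s + 2 √m) t + l` and of `a t² - (s - 2 √m) t + l`. -/
noncomputable def smallRoot (a b l : ℝ) : ℝ := (b - √(b ^ 2 - 4 * a * l)) / (2 * a)

/-- The larger root of `a t² - b t + l`. -/
noncomputable def largeRoot (a b l : ℝ) : ℝ := (b + √(b ^ 2 - 4 * a * l)) / (2 * a)

/-- For real `a ≤ b`, the analytic square root of `(z - a) (z - b)` on `ℂ ∖ [a, b]` which is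
equivalent to `z` at infinity (`Complex.sqrt` is the principal square root, and
`(z - a) / (z - b)` is a non-positive real number only for `z ∈ [a, b]`). -/
noncomputable def cutSqrt (a b : ℝ) (z : ℂ) : ℂ := (z - b) * Complex.sqrt ((z - a) / (z - b))

namespace WalkParams

variable (p : WalkParams)

/-- The stability (ergodicity) condition of the random walk. -/
def Stable : Prop :=
  p.mu₁ * p.c₁ < p.lam₁ ∧ p.mu₁ * p.c₁ + p.mu₂ * p.c₂ < p.lam₁ + p.lam₂

/-- The total rate `λ₁ + λ₂ + μ₁ c₁ + μ₂ c₂`. -/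
def total : ℝ := p.lam₁ + p.lam₂ + p.mu₁ * p.c₁ + p.mu₂ * p.c₂

/-- The kernel `K(x, y)`. -/
def K (x y : ℂ) : ℂ :=
  p.mu₁ * p.c₁ * x ^ 2 * y + p.mu₂ * p.c₂ * x * y ^ 2 - p.total * x * y + p.lam₁ * y + p.lam₂ * x

/-- The discriminant of `K(x, y)` as a polynomial in `x`, for real `y`. -/
def Δ₁ (y : ℝ) : ℝ :=
  (p.mu₂ * p.c₂ * y ^ 2 - p.total * y + p.lam₂) ^ 2 - 4 * (p.mu₁ * p.c₁) * p.lam₁ * y ^ 2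

/-- The discriminant of `K(x, y)` as a polynomial in `y`. -/
def Δ₂ (x : ℂ) : ℂ :=
  (p.mu₁ * p.c₁ * x ^ 2 - p.total * x + p.lam₁) ^ 2 - 4 * (p.mu₂ * p.c₂) * p.lam₂ * x ^ 2

/-- The two smallest of the four roots `y₁ < y₂ < 1 < y₃ < y₄` of `Δ₁`. -/
noncomputable def y₁ : ℝ :=
  smallRoot (p.mu₂ * p.c₂) (p.total + 2 * √(p.mu₁ * p.c₁ * p.lam₁)) p.lam₂

/-- See `y₁`. -/
noncomputable def y₂ : ℝ :=
  smallRoot (p.mu₂ * p.c₂) (p.total - 2 * √(p.mu₁ * p.c₁ * p.lam₁)) p.lam₂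

/-- The four roots `x₁ < x₂ < x₃ < x₄` of `Δ₂`. -/
noncomputable def x₁ : ℝ :=
  smallRoot (p.mu₁ * p.c₁) (p.total + 2 * √(p.mu₂ * p.c₂ * p.lam₂)) p.lam₁

/-- See `x₁`. -/
noncomputable def x₂ : ℝ :=
  smallRoot (p.mu₁ * p.c₁) (p.total - 2 * √(p.mu₂ * p.c₂ * p.lam₂)) p.lam₁

/-- See `x₁`. -/
noncomputable def x₃ : ℝ :=
  largeRoot (p.mu₁ * p.c₁) (p.total - 2 * √(p.mu₂ * p.c₂ * p.lam₂)) p.lam₁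

/-- See `x₁`. -/
noncomputable def x₄ : ℝ :=
  largeRoot (p.mu₁ * p.c₁) (p.total + 2 * √(p.mu₂ * p.c₂ * p.lam₂)) p.lam₁

/-- The radius `r₁ = √(λ₁ / (μ₁ c₁))`. -/
noncomputable def r₁ : ℝ := √(p.lam₁ / (p.mu₁ * p.c₁))

/-- The analytic extension to `ℂ ∖ ([x₁, x₂] ∪ [x₃, x₄])` of `√Δ₂` near `0`; see `σ₂_sq`,
`differentiableAt_σ₂` and `σ₂_zero` below, which characterize it. -/
noncomputable def σ₂ (x : ℂ) : ℂ :=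
  p.mu₁ * p.c₁ * (cutSqrt p.x₁ p.x₂ x * cutSqrt p.x₃ p.x₄ x)

/-- The root `Y₀(x)` of `K(x, ·)` which is null at the origin, analytic in
`ℂ ∖ ([x₁, x₂] ∪ [x₃, x₄])` (at `x = 0` the formula reads `0 / 0 = 0`). -/
noncomputable def Y₀ (x : ℂ) : ℂ :=
  (-(p.mu₁ * p.c₁ * x ^ 2 - p.total * x + p.lam₁) + p.σ₂ x) / (2 * (p.mu₂ * p.c₂) * x)

/-- The coefficient `α₁` of the Riemann–Hilbert problem, on the circle of radius `r₁`. -/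
noncomputable def α₁ (x : ℂ) : ℂ :=
  (starRingEnd ℂ x * (p.Y₀ x - x)) / (x * (p.Y₀ x - starRingEnd ℂ x))

/-- The angle `Θ₁(y)`, for `y ∈ [y₁, y₂]`. -/
noncomputable def Θ₁ (y : ℝ) : ℝ :=
  Real.arctan (√(-p.Δ₁ y) /
    (p.mu₂ * p.c₂ * y ^ 2 - p.total * y + 2 * p.lam₁ + p.lam₂))

/-- The integrand `(λ₂ - μ₂ c₂ y²) Θ₁(y) / (y K(x, y))`. -/
noncomputable def integrand (x : ℂ) (y : ℝ) : ℂ :=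
  ((p.lam₂ - p.mu₂ * p.c₂ * y ^ 2) * p.Θ₁ y : ℝ) / (y * p.K x y)

end WalkParams

/-! ### The homogeneous Riemann–Hilbert problem on a circle -/

/-- The homogeneous Riemann–Hilbert problem with coefficient `α` on the circle of centre `0` and
radius `r`: `φ` is analytic inside and outside the circle, has an interior limit `φⁱ` and an
exterior limit `φᵉ` at every point of the circle, and `φⁱ = α φᵉ` there. The values of `φ` on
the circle itself play no role. -/
structure SolvesHomogeneousRH (r : ℝ) (α φ : ℂ → ℂ) : Prop where
  analytic_interior : AnalyticOnNhd ℂ φ {z | ‖z‖ < r}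
  analytic_exterior : AnalyticOnNhd ℂ φ {z | r < ‖z‖}
  jump : ∀ z : ℂ, ‖z‖ = r → ∃ φi φe : ℂ,
    Tendsto φ (𝓝[{w | ‖w‖ < r}] z) (𝓝 φi) ∧ Tendsto φ (𝓝[{w | r < ‖w‖}] z) (𝓝 φe) ∧
      φi = α z * φe

/-- `κ` is the index of the problem with coefficient `α` on the circle of radius `r`: `α` has no
zero on the circle, and `2 π κ` is the variation of a continuous determination `θ` of `arg α`
along the circle, described once counterclockwise. -/
def HasIndex (r : ℝ) (α : ℂ → ℂ) (κ : ℝ) : Prop :=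
  ∃ θ : ℝ → ℝ, ContinuousOn θ (Set.Icc 0 (2 * Real.pi)) ∧
    (∀ t ∈ Set.Icc 0 (2 * Real.pi), α (circleMap 0 r t) ≠ 0 ∧
      α (circleMap 0 r t) = ‖α (circleMap 0 r t)‖ * Complex.exp (θ t * Complex.I)) ∧
    θ (2 * Real.pi) - θ 0 = 2 * Real.pi * κ

/-! ### The branch points are ordered as announced, and `σ₂` is the announced square root -/

theorem disc_pos {a l m n s : ℝ} (ha : 0 < a) (hl : 0 < l) (hm : 0 < m) (hn : 0 < n)
    (hs : s = a + l + m + n) (hne : a ≠ l) :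
    2 * √(a * l) < s - 2 * √(m * n) := by
  have h1 := Real.sq_sqrt ha.le
  have h2 := Real.sq_sqrt hl.le
  have h3 := Real.sq_sqrt hm.le
  have h4 := Real.sq_sqrt hn.le
  rw [Real.sqrt_mul ha.le, Real.sqrt_mul hm.le]
  have h5 : √a - √l ≠ 0 := by
    intro h
    apply hne
    rw [← h1, ← h2, sub_eq_zero.mp h]
  have := sq_nonneg (√m - √n)
  have := pow_pos (abs_pos.mpr h5) 2
  rw [sq_abs] at this
  nlinarith

theorem root_facts {a b l : ℝ} (ha : 0 < a) (hl : 0 < l) (hb : 2 * √(a * l) < b) :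
    0 < smallRoot a b l ∧ smallRoot a b l < largeRoot a b l ∧
      a * (smallRoot a b l + largeRoot a b l) = b ∧
      a * (smallRoot a b l * largeRoot a b l) = l := by
  have hal := mul_pos ha hl
  have h0 := Real.sq_sqrt hal.le
  have h00 := Real.sqrt_nonneg (a * l)
  have hd : 0 < b ^ 2 - 4 * a * l := by nlinarith
  have h1 := Real.sq_sqrt hd.le
  have h2 := Real.sqrt_pos.mpr hd
  have h3 : √(b ^ 2 - 4 * a * l) < b := by nlinarith
  unfold smallRoot largeRoot
  refine ⟨by apply div_pos <;> linarith, by gcongr; linarith, by field_simp; ring, ?_⟩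
  generalize √(b ^ 2 - 4 * a * l) = d at h1
  field_simp
  linear_combination -h1

theorem root_order {a b b' l : ℝ} (ha : 0 < a) (hl : 0 < l) (hb : 2 * √(a * l) < b)
    (hb' : b < b') :
    smallRoot a b' l < smallRoot a b l ∧ largeRoot a b l < largeRoot a b' l := by
  obtain ⟨h1, h2, h3, h4⟩ := root_facts ha hl hb
  obtain ⟨k1, k2, k3, k4⟩ := root_facts ha hl (hb.trans hb')
  have hL : largeRoot a b l < largeRoot a b' l := by
    unfold largeRoot
    have h00 := Real.sqrt_nonneg (a * l)
    have hbb : b ^ 2 < b' ^ 2 := by nlinarith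
    have hd := Real.sqrt_le_sqrt (show b ^ 2 - 4 * a * l ≤ b' ^ 2 - 4 * a * l by linarith)
    gcongr 1
    linarith
  refine ⟨?_, hL⟩
  by_contra! h
  have e1 := mul_le_mul_of_nonneg_right h (h1.trans h2).le
  have e2 := mul_lt_mul_of_pos_left hL k1
  have e3 := mul_lt_mul_of_pos_left (e1.trans_lt e2) ha
  linarith

theorem cutSqrt_sq (a b : ℝ) (z : ℂ) : cutSqrt a b z ^ 2 = (z - a) * (z - b) := by
  unfold cutSqrt
  by_cases h : z - b = 0
  · simp [h]
  · rw [mul_pow]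
    have : Complex.sqrt ((z - a) / (z - b)) ^ 2 = (z - a) / (z - b) := by
      simp [Complex.sqrt]
    rw [this]
    field_simp

theorem cutSqrt_zero {a b : ℝ} (ha : 0 < a) (hb : 0 < b) : cutSqrt a b 0 = (-√(a * b) : ℝ) := by
  unfold cutSqrt
  have h1 : ((0 : ℂ) - a) / (0 - b) = ((a / b : ℝ) : ℂ) := by simp
  have h2 : Complex.sqrt ((a / b : ℝ) : ℂ) = (√(a / b) : ℝ) := by
    have h := Complex.ofReal_cpow (div_nonneg ha.le hb.le) (2⁻¹ : ℝ)
    rw [Real.sqrt_eq_rpow, one_div, h]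
    simp [Complex.sqrt]
  rw [h1, h2, zero_sub, ← Complex.ofReal_neg, ← Complex.ofReal_mul]
  congr 1
  rw [Real.sqrt_div ha.le, Real.sqrt_mul ha.le]
  have := Real.mul_self_sqrt hb.le
  have h3 := Real.sqrt_pos.mpr hb
  field_simp
  nlinarith

theorem differentiableAt_cutSqrt {a b : ℝ} (hab : a < b) {z : ℂ}
    (hz : z ∉ ((↑) : ℝ → ℂ) '' Set.Icc a b) : DifferentiableAt ℂ (cutSqrt a b) z := by
  have hzb : z - b ≠ 0 := fun h => hz ⟨b, ⟨hab.le, le_rfl⟩, (sub_eq_zero.mp h).symm⟩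
  have hs : (z - a) / (z - b) ∈ Complex.slitPlane := by
    by_contra hn
    rw [Complex.mem_slitPlane_iff_not_le_zero, not_not] at hn
    obtain ⟨t, ht, hte⟩ : ∃ t : ℝ, t ≤ 0 ∧ (z - a) / (z - b) = t := by
      rw [Complex.le_def] at hn
      exact ⟨((z - a) / (z - b)).re, hn.1, Complex.ext rfl (by simpa using hn.2)⟩
    rw [div_eq_iff hzb] at hte
    have h1 : (1 - t : ℝ) ≠ 0 := by linarith
    have h1' : (1 - t : ℂ) ≠ 0 := by exact_mod_cast h1
    refine hz ⟨(a - t * b) / (1 - t), ⟨?_, ?_⟩, ?_⟩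
    · rw [le_div_iff₀ (by linarith)]
      nlinarith
    · rw [div_le_iff₀ (by linarith)]
      nlinarith
    · push_cast
      rw [div_eq_iff h1']
      linear_combination -hte
  have h1 : DifferentiableAt ℂ (fun z : ℂ => (z - a) / (z - b)) z := by fun_prop (disch := exact hzb)
  have h2 := DifferentiableAt.comp z (g := Complex.sqrt) (Complex.differentiableAt_sqrt hs) h1
  exact DifferentiableAt.mul (by fun_prop) h2

namespace WalkParams

variable {p : WalkParams}

theorem a_pos : 0 < p.mu₁ * p.c₁ := mul_pos p.mu₁_pos p.c₁_pos

theorem b_pos : 0 < p.mu₂ * p.c₂ := mul_pos p.mu₂_pos p.c₂_pos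

theorem sqrt_pos₂ : 0 < √(p.mu₂ * p.c₂ * p.lam₂) := Real.sqrt_pos.mpr (mul_pos b_pos p.lam₂_pos)

theorem disc₂ (hp : p.Stable) :
    2 * √(p.mu₁ * p.c₁ * p.lam₁) < p.total - 2 * √(p.mu₂ * p.c₂ * p.lam₂) :=
  disc_pos a_pos p.lam₁_pos b_pos p.lam₂_pos (by unfold total; ring) hp.1.ne

theorem disc₂' (hp : p.Stable) :
    2 * √(p.mu₁ * p.c₁ * p.lam₁) < p.total + 2 * √(p.mu₂ * p.c₂ * p.lam₂) := by
  linarith [disc₂ hp, sqrt_pos₂ (p := p)]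

theorem x_order (hp : p.Stable) : 0 < p.x₁ ∧ p.x₁ < p.x₂ ∧ p.x₂ < p.x₃ ∧ p.x₃ < p.x₄ := by
  have h := root_order a_pos p.lam₁_pos (disc₂ hp)
    (show _ < p.total + 2 * √(p.mu₂ * p.c₂ * p.lam₂) by linarith [sqrt_pos₂ (p := p)])
  exact ⟨(root_facts a_pos p.lam₁_pos (disc₂' hp)).1, h.1,
    (root_facts a_pos p.lam₁_pos (disc₂ hp)).2.1, h.2⟩

/-- The bounds `0 < y₁ < y₂ < 1`. -/
theorem y_order (hp : p.Stable) : 0 < p.y₁ ∧ p.y₁ < p.y₂ ∧ p.y₂ < 1 := by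
  have hs : 0 < √(p.mu₁ * p.c₁ * p.lam₁) := Real.sqrt_pos.mpr (mul_pos a_pos p.lam₁_pos)
  have hd : 2 * √(p.mu₂ * p.c₂ * p.lam₂) < p.total - 2 * √(p.mu₁ * p.c₁ * p.lam₁) := by
    linarith [disc₂ hp]
  have hf := root_facts b_pos p.lam₂_pos hd
  have h := root_order b_pos p.lam₂_pos hd
    (show _ < p.total + 2 * √(p.mu₁ * p.c₁ * p.lam₁) by linarith)
  refine ⟨(root_facts b_pos p.lam₂_pos (by linarith)).1, h.1, ?_⟩
  by_contra! h1
  unfold y₂ at h1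
  have hlt : 2 * √(p.mu₁ * p.c₁ * p.lam₁) < p.mu₁ * p.c₁ + p.lam₁ := by
    rw [Real.sqrt_mul a_pos.le]
    nlinarith [Real.sq_sqrt (a_pos (p := p)).le, Real.sq_sqrt p.lam₁_pos.le,
      Real.sqrt_lt_sqrt a_pos.le hp.1]
  obtain ⟨-, g2, g3, g4⟩ := hf
  unfold total at *
  nlinarith [mul_nonneg (sub_nonneg.mpr h1) (sub_nonneg.mpr (h1.trans g2.le)), b_pos (p := p)]

/-- `y₁` and `y₂` are zeros of `Δ₁`. -/
theorem Δ₁_y (hp : p.Stable) : p.Δ₁ p.y₁ = 0 ∧ p.Δ₁ p.y₂ = 0 := by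
  have hs : 0 < √(p.mu₁ * p.c₁ * p.lam₁) := Real.sqrt_pos.mpr (mul_pos a_pos p.lam₁_pos)
  have hq := Real.sq_sqrt (mul_pos (a_pos (p := p)) p.lam₁_pos).le
  have hd : 2 * √(p.mu₂ * p.c₂ * p.lam₂) < p.total - 2 * √(p.mu₁ * p.c₁ * p.lam₁) := by
    linarith [disc₂ hp]
  obtain ⟨-, -, g3, g4⟩ := root_facts b_pos p.lam₂_pos hd
  obtain ⟨-, -, k3, k4⟩ := root_facts b_pos p.lam₂_pos
    (show _ < p.total + 2 * √(p.mu₁ * p.c₁ * p.lam₁) by linarith)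
  have e1 : p.mu₂ * p.c₂ * p.y₁ ^ 2 - p.total * p.y₁ + p.lam₂ =
      2 * √(p.mu₁ * p.c₁ * p.lam₁) * p.y₁ := by
    change _ * (p.y₁ + _) = _ at k3
    change _ * (p.y₁ * _) = _ at k4
    linear_combination p.y₁ * k3 - k4
  have e2 : p.mu₂ * p.c₂ * p.y₂ ^ 2 - p.total * p.y₂ + p.lam₂ =
      -2 * √(p.mu₁ * p.c₁ * p.lam₁) * p.y₂ := by
    change _ * (p.y₂ + _) = _ at g3
    change _ * (p.y₂ * _) = _ at g4
    linear_combination p.y₂ * g3 - g4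
  unfold Δ₁
  rw [e1, e2]
  exact ⟨by linear_combination 4 * p.y₁ ^ 2 * hq, by linear_combination 4 * p.y₂ ^ 2 * hq⟩

/-- `σ₂` is a square root of `Δ₂`. -/
theorem σ₂_sq (hp : p.Stable) (x : ℂ) : p.σ₂ x ^ 2 = p.Δ₂ x := by
  obtain ⟨-, -, g3, g4⟩ := root_facts a_pos p.lam₁_pos (disc₂ hp)
  obtain ⟨-, -, k3, k4⟩ := root_facts a_pos p.lam₁_pos (disc₂' hp)
  have hq := Real.sq_sqrt (mul_pos (b_pos (p := p)) p.lam₂_pos).le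
  have e : p.σ₂ x ^ 2 = (p.mu₁ * p.c₁ * ((x - p.x₁) * (x - p.x₄))) *
      (p.mu₁ * p.c₁ * ((x - p.x₂) * (x - p.x₃))) := by
    rw [σ₂, mul_pow, mul_pow _ _ 2, mul_pow (cutSqrt _ _ _), cutSqrt_sq, cutSqrt_sq]; ring
  have e1 : (p.mu₁ * p.c₁ * ((x - p.x₁) * (x - p.x₄)) : ℂ) = p.mu₁ * p.c₁ * x ^ 2 -
      (p.total + 2 * √(p.mu₂ * p.c₂ * p.lam₂) : ℝ) * x + p.lam₁ := by
    have k3' := congrArg (Complex.ofReal) k3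
    have k4' := congrArg (Complex.ofReal) k4
    unfold x₁ x₄; push_cast at k3' k4' ⊢; linear_combination (-x) * k3' + k4'
  have e2 : (p.mu₁ * p.c₁ * ((x - p.x₂) * (x - p.x₃)) : ℂ) = p.mu₁ * p.c₁ * x ^ 2 -
      (p.total - 2 * √(p.mu₂ * p.c₂ * p.lam₂) : ℝ) * x + p.lam₁ := by
    have g3' := congrArg (Complex.ofReal) g3
    have g4' := congrArg (Complex.ofReal) g4
    unfold x₂ x₃; push_cast at g3' g4' ⊢; linear_combination (-x) * g3' + g4'
  rw [e, e1, e2, Δ₂]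
  have hq' : ((√(p.mu₂ * p.c₂ * p.lam₂) : ℝ) : ℂ) ^ 2 = p.mu₂ * p.c₂ * p.lam₂ := by
    exact_mod_cast hq
  push_cast
  linear_combination (-4 * x ^ 2) * hq'

/-- `σ₂` is analytic off the cuts. -/
theorem differentiableAt_σ₂ (hp : p.Stable) {x : ℂ}
    (hx : x ∉ ((↑) : ℝ → ℂ) '' (Set.Icc p.x₁ p.x₂ ∪ Set.Icc p.x₃ p.x₄)) :
    DifferentiableAt ℂ p.σ₂ x := by
  rw [Set.image_union, Set.mem_union, not_or] at hx
  obtain ⟨-, h1, -, h2⟩ := x_order hp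
  exact ((differentiableAt_cutSqrt h1 hx.1).mul (differentiableAt_cutSqrt h2 hx.2)).const_mul _

/-- `σ₂ 0 = √(Δ₂ 0)`, the positive square root of `λ₁²`. -/
theorem σ₂_zero (hp : p.Stable) : p.σ₂ 0 = p.lam₁ := by
  obtain ⟨h1, h2, h3, h4⟩ := x_order hp
  obtain ⟨-, -, -, g4⟩ := root_facts a_pos p.lam₁_pos (disc₂ hp)
  obtain ⟨-, -, -, k4⟩ := root_facts a_pos p.lam₁_pos (disc₂' hp)
  change _ * (p.x₂ * p.x₃) = _ at g4
  change _ * (p.x₁ * p.x₄) = _ at k4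
  have h2' := h1.trans h2
  have h3' := h2'.trans h3
  have h4' := h3'.trans h4
  rw [σ₂, cutSqrt_zero h1 h2', cutSqrt_zero h3' h4']
  norm_cast
  rw [neg_mul_neg, ← Real.sqrt_mul (mul_pos h1 h2').le]
  have : p.x₁ * p.x₂ * (p.x₃ * p.x₄) = (p.lam₁ / (p.mu₁ * p.c₁)) ^ 2 := by
    have ha := (a_pos (p := p)).ne'
    rw [sq, div_mul_div_comm, eq_div_iff (mul_ne_zero ha ha)]
    linear_combination (p.mu₁ * p.c₁ * (p.x₁ * p.x₄)) * g4 + p.lam₁ * k4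
  rw [this, Real.sqrt_sq (div_pos p.lam₁_pos a_pos).le]
  exact mul_div_cancel₀ _ (a_pos (p := p)).ne'

end WalkParams

/-! Write `a = μ₁ c₁`. On the circle, `a x (conj x) = λ₁`, so `K(x, ·) / x` is a real quadratic
whose linear coefficient depends only on `x + conj x = 2 r₁ cos θ`. The branch `Y₀` is its smaller
root (`Y₀_circleMap`); it is real and lies in `[y₁, y₂]`, and stability gives `y₂ < 1 < r₁`. Hence
`1 - Y₀ / x` stays in the right half-plane, and `α₁` is the quotient of this number by its
conjugate. Its logarithm is therefore single-valued, equal to `2 i` times an arctangent: the index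
is zero.

Since the circle passes between the two cuts, this logarithm `h` is analytic near the circle. A
Laurent splitting `h = P + N` gives the solution `exp P` inside and `exp (-N)` outside. Dividing any
other solution by it removes the jump, and a Liouville argument makes the quotient constant
(`homogeneousRH_of_eq_exp`, `eq_limit_of_no_jump`).

It remains to rewrite the Cauchy integral `P` of `h`. The angle is odd in `θ`, so pairing `θ` with
`-θ` leaves an integral over `[0, π]`. The substitution `y = Y₀(r₁ exp (i θ))` turns it into the
integral over `[y₁, y₂]`, because the roots of `K(·, y)` are the two conjugate points of the circle
(`K_circleRoot`, `cauchyIntegral_logα₁`). -/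

/-! ### Removing the jump across a circle -/

/-- A function which is analytic off a circle, with equal interior and exterior limits at each
point of the circle and with limit `C` at infinity, is equal to `C` inside the circle. -/
theorem eq_limit_of_no_jump {r : ℝ} (hr : 0 < r) {f : ℂ → ℂ} {C : ℂ}
    (hi : AnalyticOnNhd ℂ f {z | ‖z‖ < r}) (he : AnalyticOnNhd ℂ f {z | r < ‖z‖})
    (hb : ∀ z : ℂ, ‖z‖ = r → ∃ w : ℂ, Tendsto f (𝓝[{w | ‖w‖ < r}] z) (𝓝 w) ∧
      Tendsto f (𝓝[{w | r < ‖w‖}] z) (𝓝 w))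
    (hC : Tendsto f (Bornology.cobounded ℂ) (𝓝 C)) {x : ℂ} (hx : ‖x‖ < r) : f x = C := by
  have hunion : {z : ℂ | ‖z‖ < r} ∪ {z | r < ‖z‖} = (Metric.sphere 0 r)ᶜ := by
    ext z; simp
  have hdense : Dense ((Metric.sphere (0 : ℂ) r)ᶜ) := by
    rw [← interior_eq_empty_iff_dense_compl, interior_sphere _ hr.ne']
  have hA : ∀ z ∈ (Metric.sphere (0 : ℂ) r)ᶜ, AnalyticAt ℂ f z := by
    rw [← hunion]
    rintro z (hz | hz)
    exacts [hi z hz, he z hz]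
  -- The values of `f` on the circle are arbitrary; they are replaced by the common limits.
  set F := extendFrom ((Metric.sphere (0 : ℂ) r)ᶜ) f with hF
  have hFf : ∀ z ∈ (Metric.sphere (0 : ℂ) r)ᶜ, F z = f z := extendFrom_extends
    fun z hz => (hA z hz).continuousAt.continuousWithinAt
  have hFc : Continuous F := by
    refine continuous_extendFrom hdense fun z => ?_
    by_cases hz : ‖z‖ = r
    · obtain ⟨w, h1, h2⟩ := hb z hz
      refine ⟨w, ?_⟩
      rw [← hunion, nhdsWithin_union]
      exact h1.sup h2
    · exact ⟨f z, (hA z (by simpa using hz)).continuousAt.continuousWithinAt⟩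
  have hFd : ∀ z ∈ (Metric.sphere (0 : ℂ) r)ᶜ, DifferentiableAt ℂ F z := fun z hz =>
    (hA z hz).differentiableAt.congr_of_eventuallyEq
      (Filter.eventually_of_mem (Metric.isClosed_sphere.isOpen_compl.mem_nhds hz) hFf)
  have hFC : Tendsto F (Bornology.cobounded ℂ) (𝓝 C) := by
    refine hC.congr' ?_
    have : ∀ᶠ z : ℂ in Bornology.cobounded ℂ, r < ‖z‖ :=
      tendsto_norm_cobounded_atTop.eventually_gt_atTop r
    filter_upwards [this] with z hz
    exact (hFf z (by simpa using hz.ne')).symm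
  -- Analyticity of `F` across the circle is never needed: Cauchy's formula in the disc and the
  -- deformation in the annulus only ask for continuity up to the boundary.
  have hcauchy : ∀ R, r ≤ R → (∮ t in C(0, R), (t - x)⁻¹ • F t) =
      (2 * Real.pi * Complex.I : ℂ) • F x := by
    intro R hR
    have hne : ∀ t : ℂ, r ≤ ‖t‖ → t - x ≠ 0 := fun t ht h => by
      rw [sub_eq_zero.mp h] at ht; linarith
    rw [Complex.circleIntegral_eq_of_differentiable_on_annulus_off_countable hr hR
      Set.countable_empty]
    · refine DiffContOnCl.circleIntegral_sub_inv_smul ⟨fun z hz => ?_, hFc.continuousOn⟩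
        (by simpa using hx)
      refine (hFd z ?_).differentiableWithinAt
      simp only [Metric.mem_ball, dist_zero_right] at hz
      simpa using hz.ne
    · refine ContinuousOn.smul (ContinuousOn.inv₀ (by fun_prop) fun t ht => hne t ?_)
        hFc.continuousOn
      simpa using ht.2
    · rintro z ⟨⟨-, hz⟩, -⟩
      have hz' : r < ‖z‖ := by simpa using hz
      exact DifferentiableAt.smul
        ((differentiableAt_id.sub_const x).inv (hne z hz'.le)) (hFd z (by simpa using hz'.ne'))
  -- The factor 2 comes from `R ≥ 2 r`: then `‖t - x‖ ≥ R / 2` on the circle of radius `R`.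
  have hbound : ∀ ε > 0, ‖F x - C‖ ≤ 2 * ε := by
    intro ε hε
    have h1 : ∀ᶠ z in Bornology.cobounded ℂ, ‖F z - C‖ < ε := by
      simpa [dist_eq_norm] using hFC.eventually (Metric.ball_mem_nhds C hε)
    rw [← comap_norm_atTop, eventually_comap] at h1
    obtain ⟨R, h1, hR⟩ := (h1.and (eventually_ge_atTop (2 * r))).exists
    have hR0 : 0 < R := by linarith
    have hI1 := hcauchy R (by linarith)
    have hI2 : (∮ t in C(0, R), (t - x)⁻¹ • C) = (2 * Real.pi * Complex.I : ℂ) • C :=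
      DiffContOnCl.circleIntegral_sub_inv_smul (diffContOnCl_const)
        (by simp only [Metric.mem_ball, dist_zero_right]; linarith)
    have hne : ∀ t ∈ Metric.sphere (0 : ℂ) R, t - x ≠ 0 := fun t ht h => by
      rw [sub_eq_zero.mp h] at ht
      simp only [mem_sphere_iff_norm, sub_zero] at ht; linarith
    have hci : ContinuousOn (fun t : ℂ => (t - x)⁻¹) (Metric.sphere 0 R) :=
      ContinuousOn.inv₀ (by fun_prop) hne
    have hI3 : (∮ t in C(0, R), (t - x)⁻¹ • (F t - C)) =
        (2 * Real.pi * Complex.I : ℂ) • (F x - C) := by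
      rw [smul_sub, ← hI1, ← hI2, ← circleIntegral.integral_sub]
      · simp only [smul_sub]
      · exact (hci.smul hFc.continuousOn).circleIntegrable hR0.le
      · exact (hci.smul continuousOn_const).circleIntegrable hR0.le
    have hI4 := circleIntegral.norm_two_pi_i_inv_smul_integral_le_of_norm_le_const
      (f := fun t => (t - x)⁻¹ • (F t - C)) (c := 0) (R := R) (C := (R / 2)⁻¹ * ε) hR0.le ?_
    · rw [hI3, inv_smul_smul₀ Complex.two_pi_I_ne_zero] at hI4
      refine hI4.trans_eq ?_
      field_simp
    · intro t ht
      have hz : ‖t‖ = R := by simpa using ht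
      rw [norm_smul, norm_inv]
      have h2 : R / 2 ≤ ‖t - x‖ := by
        have := norm_sub_norm_le t x
        linarith
      have h3 := (h1 t hz).le
      have h4 : 0 < R / 2 := by linarith
      gcongr
  have h0 : ‖F x - C‖ ≤ 0 := by
    refine le_of_forall_pos_le_add fun ε hε => ?_
    have := hbound (ε / 2) (by linarith)
    linarith
  have h1 : F x = C := by simpa [sub_eq_zero] using h0
  rw [← h1, hFf x (by simpa using hx.ne)]

/-! ### Splitting a function analytic near a circle -/

/-- The Cauchy integral over a circle, as an analytic function in the disc. -/
theorem analyticOnNhd_cauchyIntegral {R : ℝ} (hR : 0 < R) {g : ℂ → ℂ}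
    (hg : ContinuousOn g (Metric.sphere 0 R)) :
    AnalyticOnNhd ℂ (fun w => (2 * Real.pi * Complex.I : ℂ)⁻¹ • ∮ t in C(0, R), (t - w)⁻¹ • g t)
      {w | ‖w‖ < R} := by
  lift R to NNReal using hR.le
  have h := hasFPowerSeriesOn_cauchy_integral (hg.circleIntegrable hR.le) (by exact_mod_cast hR)
  intro w hw
  refine h.analyticAt_of_mem ?_
  simpa [Metric.eball_coe] using hw

/-- The change of variables `t ↦ t⁻¹` in a Cauchy integral. -/
theorem cauchyIntegral_inv {R : ℝ} (hR : 0 < R) (g : ℂ → ℂ) {x : ℂ} (hx : R < ‖x‖) :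
    (∮ t in C(0, R), (t - x)⁻¹ • g t) =
      -x⁻¹ * ∮ t in C(0, R⁻¹), (t - x⁻¹)⁻¹ • (g t⁻¹ * t⁻¹) := by
  set G : ℝ → ℂ := fun θ => deriv (circleMap 0 R) θ • (circleMap 0 R θ - x)⁻¹ •
    g (circleMap 0 R θ) with hG
  have hper : Function.Periodic G (2 * Real.pi) := fun θ => by
    simp only [hG, deriv_circleMap, periodic_circleMap (0 : ℂ) R θ]
  -- Inversion reverses the orientation of the circle, hence `θ ↦ -θ`; periodicity restores the
  -- interval.
  have h1 : (∫ θ in (0 : ℝ)..2 * Real.pi, G (-θ)) = ∫ θ in (0 : ℝ)..2 * Real.pi, G θ := by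
    rw [intervalIntegral.integral_comp_neg]
    have := hper.intervalIntegral_add_eq (-(2 * Real.pi)) 0
    simpa using this
  have hx0 : x ≠ 0 := norm_pos_iff.mp (hR.trans hx)
  rw [circleIntegral, circleIntegral, ← intervalIntegral.integral_const_mul]
  refine h1.symm.trans (intervalIntegral.integral_congr fun θ _ => ?_)
  have hc0 : circleMap 0 R (-θ) ≠ 0 := circleMap_ne_center hR.ne'
  have hinv : circleMap 0 R⁻¹ θ = (circleMap 0 R (-θ))⁻¹ := by
    simp [circleMap, ← Complex.exp_neg, mul_comm]
  have hcx : circleMap 0 R (-θ) - x ≠ 0 := fun h => by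
    have := congrArg norm (sub_eq_zero.mp h)
    rw [norm_circleMap_zero, abs_of_pos hR] at this
    linarith
  have hcx' : x - circleMap 0 R (-θ) ≠ 0 := fun h => hcx (by linear_combination -h)
  simp only [hG, deriv_circleMap, hinv, inv_inv, smul_eq_mul]
  generalize circleMap 0 R (-θ) = c at *
  have hd : c⁻¹ - x⁻¹ = (x - c) / (c * x) := by field_simp
  rw [hd]
  field_simp
  ring

/-- A function `h` analytic on an annulus is the sum of a function analytic inside the outer
circle and of a function analytic outside the inner circle which vanishes at infinity. -/
theorem exists_splitting_annulus {R₁ R₂ : ℝ} (hR₁ : 0 < R₁) (hR : R₁ < R₂) {h : ℂ → ℂ}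
    (hh : ∀ z, R₁ ≤ ‖z‖ → ‖z‖ ≤ R₂ → DifferentiableAt ℂ h z) :
    ∃ P N : ℂ → ℂ, AnalyticOnNhd ℂ P {z | ‖z‖ < R₂} ∧ AnalyticOnNhd ℂ N {z | R₁ < ‖z‖} ∧
      Tendsto N (Bornology.cobounded ℂ) (𝓝 0) ∧
      (∀ z, R₁ < ‖z‖ → ‖z‖ < R₂ → h z = P z + N z) ∧
      (∀ r, R₁ < r → r < R₂ → ∀ x, ‖x‖ < r →
        P x = (2 * Real.pi * Complex.I : ℂ)⁻¹ • ∮ t in C(0, r), (t - x)⁻¹ • h t) := by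
  have hR₂ := hR₁.trans hR
  have hcont : ∀ r, R₁ ≤ r → r ≤ R₂ → ContinuousOn h (Metric.sphere 0 r) :=
    fun r h1 h2 z hz => by
      have hz' : ‖z‖ = r := by simpa using hz
      exact (hh z (by linarith) (by linarith)).continuousAt.continuousWithinAt
  -- The exterior part is `x⁻¹ Q(x⁻¹)`, with `Q` a Cauchy integral in a disc; the factor `x⁻¹` makes
  -- it vanish at infinity.
  have hQ := analyticOnNhd_cauchyIntegral (inv_pos.mpr hR₁) (g := fun t => h t⁻¹ * t⁻¹) (by
    have hne : ∀ t ∈ Metric.sphere (0 : ℂ) R₁⁻¹, t ≠ 0 := fun t ht h0 => by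
      have : ‖t‖ = R₁⁻¹ := by simpa using ht
      rw [h0, norm_zero] at this
      exact (inv_pos.mpr hR₁).ne this
    have hinv : ContinuousOn (fun t : ℂ => t⁻¹) (Metric.sphere 0 R₁⁻¹) :=
      ContinuousOn.inv₀ continuousOn_id hne
    refine ((hcont R₁ le_rfl hR.le).comp hinv fun t ht => ?_).mul hinv
    have : ‖t‖ = R₁⁻¹ := by simpa using ht
    simp [this])
  set Q : ℂ → ℂ := fun w => (2 * Real.pi * Complex.I : ℂ)⁻¹ •
    ∮ t in C(0, R₁⁻¹), (t - w)⁻¹ • (h t⁻¹ * t⁻¹) with hQdef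
  refine ⟨fun w => (2 * Real.pi * Complex.I : ℂ)⁻¹ • ∮ t in C(0, R₂), (t - w)⁻¹ • h t,
    fun x => x⁻¹ * Q x⁻¹, analyticOnNhd_cauchyIntegral hR₂ (hcont R₂ hR.le le_rfl), ?_, ?_, ?_, ?_⟩
  · intro z hz
    have hz' : R₁ < ‖z‖ := hz
    have hz0 : z ≠ 0 := norm_pos_iff.mp (hR₁.trans hz')
    have hi : AnalyticAt ℂ (fun x : ℂ => x⁻¹) z := analyticAt_inv hz0
    refine hi.mul (AnalyticAt.fun_comp (hQ z⁻¹ ?_) hi)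
    simp only [Set.mem_ofPred_eq, norm_inv]
    gcongr
  · have hQ0 : Tendsto Q (𝓝 0) (𝓝 (Q 0)) :=
      (hQ 0 (by simpa using hR₁)).continuousAt
    have hi : Tendsto (fun x : ℂ => x⁻¹) (Bornology.cobounded ℂ) (𝓝 0) :=
      tendsto_inv₀_cobounded
    simpa using hi.mul (hQ0.comp hi)
  · intro z hz1 hz2
    have hzmem : Metric.closedBall (0 : ℂ) R₂ \ Metric.ball 0 R₁ ∈ 𝓝 z := by
      have : {w : ℂ | R₁ < ‖w‖} ∩ {w | ‖w‖ < R₂} ∈ 𝓝 z :=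
        ((isOpen_lt continuous_const continuous_norm).inter
          (isOpen_lt continuous_norm continuous_const)).mem_nhds ⟨hz1, hz2⟩
      refine mem_of_superset this fun w hw => ?_
      simpa using ⟨hw.2.le, hw.1.le⟩
    -- The difference quotient is continuous at `z`, so this single exceptional point does not
    -- obstruct the deformation. Expanding both sides gives the Laurent decomposition at `z`.
    have hann : (∮ t in C(0, R₂), dslope h z t) = ∮ t in C(0, R₁), dslope h z t := by
      refine Complex.circleIntegral_eq_of_differentiable_on_annulus_off_countable hR₁ hR.le
        (Set.countable_singleton z) ?_ ?_
      · refine (continuousOn_dslope hzmem).mpr ⟨fun w hw => ?_, hh z hz1.le hz2.le⟩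
        simp only [Set.mem_sdiff, Metric.mem_closedBall, dist_zero_right, Metric.mem_ball,
          not_lt] at hw
        exact (hh w hw.2 hw.1).continuousAt.continuousWithinAt
      · rintro w ⟨⟨hw1, hw2⟩, hw3⟩
        simp only [Metric.mem_closedBall, dist_zero_right, Metric.mem_ball, not_le,
          Set.mem_singleton_iff] at hw1 hw2 hw3
        exact (differentiableAt_dslope_of_ne hw3).mpr (hh w hw2.le hw1.le)
    have hds : ∀ r, 0 < r → R₁ ≤ r → r ≤ R₂ → r ≠ ‖z‖ → (∮ t in C(0, r), dslope h z t) =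
        (∮ t in C(0, r), (t - z)⁻¹ • h t) - (∮ t in C(0, r), (t - z)⁻¹ • h z) := by
      intro r hr h1 h2 hrz
      have hne : ∀ t ∈ Metric.sphere (0 : ℂ) r, t ≠ z := fun t ht h0 => by
        rw [h0] at ht
        exact hrz (by simpa using ht.symm)
      have hci : ContinuousOn (fun t : ℂ => (t - z)⁻¹) (Metric.sphere 0 r) :=
        ContinuousOn.inv₀ (by fun_prop) fun t ht => sub_ne_zero.mpr (hne t ht)
      have i1 : CircleIntegrable (fun t => (t - z)⁻¹ • h t) 0 r :=
        (hci.smul (hcont r h1 h2)).circleIntegrable hr.le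
      have i2 : CircleIntegrable (fun t => (t - z)⁻¹ • h z) 0 r :=
        (hci.smul continuousOn_const).circleIntegrable hr.le
      rw [← circleIntegral.integral_sub i1 i2]
      refine circleIntegral.integral_congr hr.le fun t ht => ?_
      simp only [dslope_of_ne _ (hne t ht), slope_def_module, smul_sub]
    have hout : (∮ t in C(0, R₂), (t - z)⁻¹ • h z) = (2 * Real.pi * Complex.I : ℂ) • h z :=
      DiffContOnCl.circleIntegral_sub_inv_smul diffContOnCl_const (by simpa using hz2)
    have hin : (∮ t in C(0, R₁), (t - z)⁻¹ • h z) = 0 := by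
      have hne : ∀ t ∈ Metric.closedBall (0 : ℂ) R₁, t - z ≠ 0 := fun t ht h0 => by
        rw [sub_eq_zero.mp h0] at ht
        have : ‖z‖ ≤ R₁ := by simpa using ht
        linarith
      refine Complex.circleIntegral_eq_zero_of_differentiable_on_off_countable hR₁.le
        Set.countable_empty ?_ ?_
      · exact (ContinuousOn.inv₀ (by fun_prop) hne).smul continuousOn_const
      · intro t ht
        exact DifferentiableAt.smul ((differentiableAt_id.sub_const z).inv
          (hne t (Metric.ball_subset_closedBall ht.1))) (differentiableAt_const _)
    rw [hds R₂ hR₂ hR.le le_rfl hz2.ne', hds R₁ hR₁ le_rfl hR.le hz1.ne, hout, hin,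
      cauchyIntegral_inv hR₁ h hz1, smul_eq_mul] at hann
    simp only [hQdef, smul_eq_mul] at hann ⊢
    have h2pi := Complex.two_pi_I_ne_zero
    rw [← mul_right_inj' h2pi]
    field_simp
    field_simp at hann
    linear_combination -hann
  · intro r h1 h2 x hx
    have hr0 := hR₁.trans h1
    have hne : ∀ t : ℂ, r ≤ ‖t‖ → t - x ≠ 0 := fun t ht h0 => by
      rw [sub_eq_zero.mp h0] at ht
      linarith
    refine congrArg _ ?_
    refine Complex.circleIntegral_eq_of_differentiable_on_annulus_off_countable hr0 h2.le
      Set.countable_empty ?_ ?_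
    · intro t ht
      simp only [Set.mem_sdiff, Metric.mem_closedBall, dist_zero_right, Metric.mem_ball,
        not_lt] at ht
      have hc : ContinuousAt (fun t => (t - x)⁻¹) t :=
        ContinuousAt.inv₀ (by fun_prop) (hne t ht.2)
      exact (hc.smul (hh t (h1.le.trans ht.2) ht.1).continuousAt).continuousWithinAt
    · rintro t ⟨⟨ht1, ht2⟩, -⟩
      simp only [Metric.mem_closedBall, dist_zero_right, Metric.mem_ball, not_le] at ht1 ht2
      exact DifferentiableAt.smul ((differentiableAt_id.sub_const x).inv (hne t ht2.le))
        (hh t (h1.le.trans ht2.le) ht1.le)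

/-- A neighbourhood of a circle contains an annulus around it. -/
theorem exists_annulus_subset {r : ℝ} (hr : 0 < r) {U : Set ℂ} (hU : IsOpen U)
    (hrU : Metric.sphere 0 r ⊆ U) :
    ∃ R₁ R₂ : ℝ, 0 < R₁ ∧ R₁ < r ∧ r < R₂ ∧ ∀ z : ℂ, R₁ ≤ ‖z‖ → ‖z‖ ≤ R₂ → z ∈ U := by
  obtain ⟨δ, hδ, hδU⟩ := (isCompact_sphere (0 : ℂ) r).exists_cthickening_subset_open hU hrU
  refine ⟨max (r - δ) (r / 2), r + δ, lt_max_of_lt_right (by linarith), by simp [hδ, hr],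
    by linarith, fun z h1 h2 => hδU ?_⟩
  have h3 := (le_max_left _ _).trans h1
  have h4 : 0 < ‖z‖ := lt_of_lt_of_le (by linarith) ((le_max_right _ _).trans h1)
  have h4' : (‖z‖ : ℂ) ≠ 0 := by exact_mod_cast h4.ne'
  -- The witness is the radial projection of `z`; the bound `r / 2` on the inner radius keeps `z`
  -- away from `0`.
  refine Metric.mem_cthickening_of_dist_le z ((r / ‖z‖ : ℝ) * z) δ _ ?_ ?_
  · simp only [mem_sphere_iff_norm, sub_zero, norm_mul, Complex.norm_real, Real.norm_eq_abs,
      abs_of_pos (div_pos hr h4)]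
    field_simp
  · have : z - (r / ‖z‖ : ℝ) * z = ((‖z‖ - r) / ‖z‖ : ℝ) * z := by
      push_cast
      field_simp
    rw [dist_eq_norm, this, norm_mul, Complex.norm_real, Real.norm_eq_abs, abs_div,
      abs_of_pos h4, div_mul_cancel₀ _ h4.ne', abs_le]
    constructor <;> linarith

/-! ### The scalar homogeneous problem of index zero -/

/-- The solution of a homogeneous problem of index zero: if `α = exp h` on the circle, with `h`
analytic near the circle, then the problem has a solution equal to `1` at infinity, and each
solution with a finite limit at infinity is a multiple of the exponential of the Cauchy integral
of `h`. -/
theorem homogeneousRH_of_eq_exp {r : ℝ} (hr : 0 < r) {α h : ℂ → ℂ}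
    (hh : ∀ z : ℂ, ‖z‖ = r → AnalyticAt ℂ h z)
    (hα : ∀ z : ℂ, ‖z‖ = r → α z = Complex.exp (h z)) :
    (∃ φ : ℂ → ℂ, SolvesHomogeneousRH r α φ ∧ Tendsto φ (Bornology.cobounded ℂ) (𝓝 1)) ∧
    ∀ (φ : ℂ → ℂ) (C : ℂ), SolvesHomogeneousRH r α φ →
      Tendsto φ (Bornology.cobounded ℂ) (𝓝 C) → ∀ x : ℂ, ‖x‖ < r →
        φ x = C * Complex.exp
          ((2 * Real.pi * Complex.I : ℂ)⁻¹ • ∮ t in C(0, r), (t - x)⁻¹ • h t) := by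
  obtain ⟨R₁, R₂, h0, h1, h2, hU⟩ := exists_annulus_subset hr (isOpen_analyticAt ℂ h)
    (fun z hz => hh z (by simpa using hz))
  obtain ⟨P, N, hP, hN, hN0, hPN, hPc⟩ := exists_splitting_annulus h0 (h1.trans h2)
    (h := h) (fun z hz1 hz2 => (hU z hz1 hz2).differentiableAt)
  set ψ : ℂ → ℂ := fun z => if ‖z‖ < r then Complex.exp (P z) else Complex.exp (-N z) with hψ
  have hψin : ∀ z ∈ {z : ℂ | ‖z‖ < r}, Complex.exp (P z) = ψ z := fun z hz => (if_pos hz).symm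
  have hψout : ∀ z ∈ {z : ℂ | r < ‖z‖}, Complex.exp (-N z) = ψ z := fun z hz =>
    (if_neg (not_lt.mpr (le_of_lt hz))).symm
  have hψi : AnalyticOnNhd ℂ ψ {z | ‖z‖ < r} := fun z hz =>
    ((hP z (lt_trans hz h2)).cexp).congr (eventually_of_mem
      ((isOpen_lt continuous_norm continuous_const).mem_nhds hz) hψin)
  have hψe : AnalyticOnNhd ℂ ψ {z | r < ‖z‖} := fun z hz =>
    ((hN z (lt_trans h1 hz)).neg.cexp).congr (eventually_of_mem
      ((isOpen_lt continuous_const continuous_norm).mem_nhds hz) hψout)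
  have hψti : ∀ z : ℂ, ‖z‖ = r →
      Tendsto ψ (𝓝[{w | ‖w‖ < r}] z) (𝓝 (Complex.exp (P z))) := fun z hz =>
    ((hP z (hz.trans_lt h2)).cexp.continuousAt.continuousWithinAt.tendsto).congr'
      (eventually_of_mem self_mem_nhdsWithin hψin)
  have hψte : ∀ z : ℂ, ‖z‖ = r →
      Tendsto ψ (𝓝[{w | r < ‖w‖}] z) (𝓝 (Complex.exp (-N z))) := fun z hz =>
    ((hN z (h1.trans_eq hz.symm)).neg.cexp.continuousAt.continuousWithinAt.tendsto).congr'
      (eventually_of_mem self_mem_nhdsWithin hψout)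
  have hψ1 : Tendsto ψ (Bornology.cobounded ℂ) (𝓝 1) := by
    have h3 : Tendsto (fun z => Complex.exp (-N z)) (Bornology.cobounded ℂ) (𝓝 1) := by
      simpa [Function.comp_def] using (Complex.continuous_exp.tendsto _).comp hN0.neg
    refine h3.congr' ?_
    have : ∀ᶠ z : ℂ in Bornology.cobounded ℂ, r < ‖z‖ :=
      tendsto_norm_cobounded_atTop.eventually_gt_atTop r
    filter_upwards [this] with z hz using hψout z hz
  have hψ0 : ∀ z, ψ z ≠ 0 := fun z => by
    simp only [hψ]; split_ifs <;> exact Complex.exp_ne_zero _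
  have hjump : ∀ z : ℂ, ‖z‖ = r → Complex.exp (P z) = α z * Complex.exp (-N z) := fun z hz => by
    rw [hα z hz, ← Complex.exp_add, hPN z (by linarith) (by linarith)]
    ring_nf
  refine ⟨⟨ψ, ⟨hψi, hψe, fun z hz => ⟨_, _, hψti z hz, hψte z hz, hjump z hz⟩⟩, hψ1⟩, ?_⟩
  intro φ C hφ hC x hx
  -- The interior limits of `φ` and `ψ` carry the same nonzero factor `α`, which cancels in the
  -- quotient.
  have hquot : φ x / ψ x = C := by
    refine eq_limit_of_no_jump hr (f := φ / ψ)
      (fun z hz => (hφ.analytic_interior z hz).div (hψi z hz) (hψ0 z))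
      (fun z hz => (hφ.analytic_exterior z hz).div (hψe z hz) (hψ0 z))
      (fun z hz => ?_) (by simpa using hC.div hψ1 one_ne_zero) hx
    obtain ⟨φi, φe, hi, he, hj⟩ := hφ.jump z hz
    refine ⟨φi / Complex.exp (P z), hi.div (hψti z hz) (Complex.exp_ne_zero _), ?_⟩
    rw [hj, hjump z hz, mul_div_mul_left _ _ (by rw [hα z hz]; exact Complex.exp_ne_zero _)]
    exact he.div (hψte z hz) (Complex.exp_ne_zero _)
  rw [← hPc r h1 h2 x hx, hψin x hx, ← hquot, div_mul_cancel₀ _ (hψ0 x)]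

namespace WalkParams

variable {p : WalkParams}

/-! ### The kernel on the circle `|x| = r₁` -/

theorem r₁_pos : 0 < p.r₁ := Real.sqrt_pos.mpr (div_pos p.lam₁_pos a_pos)

theorem a_mul_r₁_sq : p.mu₁ * p.c₁ * p.r₁ ^ 2 = p.lam₁ := by
  rw [r₁, Real.sq_sqrt (div_pos p.lam₁_pos a_pos).le, mul_div_cancel₀ _ a_pos.ne']

theorem a_mul_r₁ : p.mu₁ * p.c₁ * p.r₁ = √(p.mu₁ * p.c₁ * p.lam₁) := by
  rw [eq_comm, Real.sqrt_eq_iff_mul_self_eq_of_pos (mul_pos a_pos r₁_pos)]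
  linear_combination p.mu₁ * p.c₁ * a_mul_r₁_sq (p := p)

theorem one_lt_r₁ (hp : p.Stable) : 1 < p.r₁ := by
  rw [r₁, Real.lt_sqrt one_pos.le, one_pow, one_lt_div a_pos]
  exact hp.1

variable (p) in
/-- The opposite `s - 2 a r₁ cos θ` of the coefficient of `y` in `K(x, y) / x`, for
`x = r₁ exp (i θ)`. -/
noncomputable def circleCoeff (θ : ℝ) : ℝ :=
  p.total - 2 * (p.mu₁ * p.c₁ * p.r₁) * Real.cos θ

variable (p) in
/-- The real root `Y₀(x)`, for `x = r₁ exp (i θ)`. -/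
noncomputable def circleRoot (θ : ℝ) : ℝ :=
  smallRoot (p.mu₂ * p.c₂) (p.circleCoeff θ) p.lam₂

/-- The worst case is `cos θ = 1`, where this is the inequality that separates `x₂` from `x₃`. -/
theorem circleCoeff_gt (hp : p.Stable) (θ : ℝ) :
    2 * √(p.mu₂ * p.c₂ * p.lam₂) < p.circleCoeff θ := by
  have h1 := disc₂ hp
  rw [← a_mul_r₁] at h1
  have h2 := mul_pos (a_pos (p := p)) (r₁_pos (p := p))
  unfold circleCoeff
  nlinarith [Real.cos_le_one θ]

theorem circleCoeff_disc_pos (hp : p.Stable) (θ : ℝ) :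
    0 < p.circleCoeff θ ^ 2 - 4 * (p.mu₂ * p.c₂) * p.lam₂ := by
  have h1 := circleCoeff_gt hp θ
  have h2 := Real.sq_sqrt (mul_pos (b_pos (p := p)) p.lam₂_pos).le
  have h3 := sqrt_pos₂ (p := p)
  nlinarith

theorem circleRoot_zero : p.circleRoot 0 = p.y₂ := by
  simp only [circleRoot, circleCoeff, y₂, a_mul_r₁, Real.cos_zero, mul_one]

theorem circleRoot_pi : p.circleRoot Real.pi = p.y₁ := by
  simp only [circleRoot, circleCoeff, y₁, a_mul_r₁, Real.cos_pi]
  ring_nf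

theorem circleRoot_pos (hp : p.Stable) (θ : ℝ) : 0 < p.circleRoot θ :=
  (root_facts b_pos p.lam₂_pos (circleCoeff_gt hp θ)).1

theorem circleRoot_quadratic (hp : p.Stable) (θ : ℝ) :
    p.mu₂ * p.c₂ * p.circleRoot θ ^ 2 - p.circleCoeff θ * p.circleRoot θ + p.lam₂ = 0 := by
  obtain ⟨-, -, h3, h4⟩ := root_facts b_pos p.lam₂_pos (circleCoeff_gt hp θ)
  unfold circleRoot
  linear_combination smallRoot (p.mu₂ * p.c₂) (p.circleCoeff θ) p.lam₂ * h3 - h4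

/-- The smaller root lies below the geometric mean of the two roots. This keeps the denominator of
the derivative of `circleRoot` positive. -/
theorem circleRoot_sq_lt (hp : p.Stable) (θ : ℝ) :
    p.mu₂ * p.c₂ * p.circleRoot θ ^ 2 < p.lam₂ := by
  obtain ⟨h1, h2, h3, h4⟩ := root_facts b_pos p.lam₂_pos (circleCoeff_gt hp θ)
  rw [← h4, sq]
  unfold circleRoot
  have := b_pos (p := p)
  gcongr

/-- The smaller root decreases as the linear coefficient grows, and that coefficient is extremal at
`θ = 0` and `θ = π`. -/
theorem circleRoot_mem_Icc (hp : p.Stable) (θ : ℝ) : p.circleRoot θ ∈ Set.Icc p.y₁ p.y₂ := by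
  have hmono : ∀ B B' : ℝ, 2 * √(p.mu₂ * p.c₂ * p.lam₂) < B → B ≤ B' →
      smallRoot (p.mu₂ * p.c₂) B' p.lam₂ ≤ smallRoot (p.mu₂ * p.c₂) B p.lam₂ := by
    intro B B' h1 h2
    rcases h2.eq_or_lt with rfl | h2
    · rfl
    · exact (root_order b_pos p.lam₂_pos h1 h2).1.le
  have h := mul_pos (a_pos (p := p)) (r₁_pos (p := p))
  rw [← circleRoot_zero, ← circleRoot_pi]
  refine ⟨hmono _ _ (circleCoeff_gt hp θ) ?_, hmono _ _ (circleCoeff_gt hp 0) ?_⟩ <;>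
    simp only [circleCoeff, Real.cos_pi, Real.cos_zero] <;>
    nlinarith [Real.cos_le_one θ, Real.neg_one_le_cos θ]

/-- Here stability enters the computation of the index, through `y₂ < 1 < r₁`. -/
theorem circleRoot_lt_r₁ (hp : p.Stable) (θ : ℝ) : p.circleRoot θ < p.r₁ :=
  ((circleRoot_mem_Icc hp θ).2.trans_lt (y_order hp).2.2).trans (one_lt_r₁ hp)

theorem r₁_sub_circleRoot_pos (hp : p.Stable) (θ : ℝ) :
    0 < p.r₁ - p.circleRoot θ * Real.cos θ := by
  have h1 := circleRoot_lt_r₁ hp θ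
  have h2 := circleRoot_pos hp θ
  nlinarith [Real.cos_le_one θ]

theorem continuous_circleCoeff : Continuous p.circleCoeff := by
  unfold circleCoeff; fun_prop

/-- The denominator is put in the form that cancels the factor `λ₂ - μ₂ c₂ y²` of `integrand` under
substitution. -/
theorem hasDerivAt_circleRoot (hp : p.Stable) (θ : ℝ) :
    HasDerivAt p.circleRoot (-(2 * (p.mu₁ * p.c₁ * p.r₁) * Real.sin θ) * p.circleRoot θ ^ 2 /
      (p.lam₂ - p.mu₂ * p.c₂ * p.circleRoot θ ^ 2)) θ := by
  have hd := circleCoeff_disc_pos hp θ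
  have hc : HasDerivAt p.circleCoeff (2 * (p.mu₁ * p.c₁ * p.r₁) * Real.sin θ) θ := by
    have := ((Real.hasDerivAt_cos θ).const_mul (2 * (p.mu₁ * p.c₁ * p.r₁))).const_sub p.total
    exact this.congr_deriv (by ring)
  have h1 := (hc.sub (((hc.pow 2).sub_const (4 * (p.mu₂ * p.c₂) * p.lam₂)).sqrt hd.ne')).div_const
    (2 * (p.mu₂ * p.c₂))
  refine HasDerivAt.congr_deriv (f := p.circleRoot) h1 ?_
  have hq := circleRoot_quadratic hp θ
  have hD : √(p.circleCoeff θ ^ 2 - 4 * (p.mu₂ * p.c₂) * p.lam₂) =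
      p.circleCoeff θ - 2 * (p.mu₂ * p.c₂) * p.circleRoot θ := by
    unfold circleRoot smallRoot
    rw [mul_div_cancel₀ _ (mul_pos two_pos b_pos).ne']
    ring
  have hD0 := Real.sqrt_pos.mpr hd
  have hlt : p.lam₂ - p.mu₂ * p.c₂ * p.circleRoot θ ^ 2 = p.circleRoot θ *
      (p.circleCoeff θ - 2 * (p.mu₂ * p.c₂) * p.circleRoot θ) := by
    linear_combination hq
  have hY := circleRoot_pos hp θ
  have hb := b_pos (p := p)
  simp only [Pi.pow_apply]
  rw [hlt]
  rw [hD] at hD0 ⊢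
  generalize p.circleCoeff θ = B at *
  generalize p.circleRoot θ = Y at *
  generalize p.mu₂ * p.c₂ = b at *
  generalize 2 * (p.mu₁ * p.c₁ * p.r₁) * Real.sin θ = e
  have := hD0.ne'
  field_simp
  ring

theorem continuous_circleRoot (hp : p.Stable) : Continuous p.circleRoot :=
  continuous_iff_continuousAt.mpr fun θ => (hasDerivAt_circleRoot hp θ).continuousAt

theorem exists_circleRoot_eq (hp : p.Stable) {y : ℝ} (hy : y ∈ Set.Icc p.y₁ p.y₂) :
    ∃ θ : ℝ, p.circleRoot θ = y := by
  rw [← circleRoot_zero, ← circleRoot_pi] at hy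
  obtain ⟨θ, -, h⟩ := intermediate_value_Icc' Real.pi_pos.le
    (continuous_circleRoot hp).continuousOn hy
  exact ⟨θ, h⟩

/-! ### Conjugate points of the circle and the branch of `Y₀` there -/

theorem circleMap_eq (r θ : ℝ) :
    circleMap 0 r θ = r * (Real.cos θ + Real.sin θ * Complex.I) := by
  simp [circleMap, Complex.exp_mul_I]

theorem circleMap_neg_eq (r θ : ℝ) :
    circleMap 0 r (-θ) = r * (Real.cos θ - Real.sin θ * Complex.I) := by
  rw [circleMap_eq, Real.cos_neg, Real.sin_neg, Complex.ofReal_neg]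
  ring

theorem circleMap_mul_circleMap_neg (r θ : ℝ) :
    circleMap 0 r θ * circleMap 0 r (-θ) = r ^ 2 := by
  rw [circleMap_eq, circleMap_neg_eq]
  have h : ((Real.cos θ : ℝ) : ℂ) ^ 2 + ((Real.sin θ : ℝ) : ℂ) ^ 2 = 1 := by
    exact_mod_cast Real.cos_sq_add_sin_sq θ
  linear_combination (r : ℂ) ^ 2 * h - (r : ℂ) ^ 2 * ((Real.sin θ : ℝ) : ℂ) ^ 2 * Complex.I_sq

theorem circleMap_add_circleMap_neg (r θ : ℝ) :
    circleMap 0 r θ + circleMap 0 r (-θ) = 2 * r * Real.cos θ := by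
  rw [circleMap_eq, circleMap_neg_eq]
  ring

theorem conj_circleMap (r θ : ℝ) :
    starRingEnd ℂ (circleMap 0 r θ) = circleMap 0 r (-θ) := by
  rw [circleMap_eq, circleMap_neg_eq]
  simp only [map_mul, map_add, Complex.conj_ofReal, Complex.conj_I]
  ring

theorem exists_circleMap_eq {r : ℝ} (hr : 0 < r) {z : ℂ} (hz : ‖z‖ = r) :
    ∃ θ : ℝ, circleMap 0 r θ = z := by
  have : z ∈ Set.range (circleMap 0 r) := by
    rw [range_circleMap, abs_of_pos hr]
    simpa using hz
  exact this

theorem circle_quadratic (θ : ℝ) :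
    p.mu₁ * p.c₁ * circleMap 0 p.r₁ θ ^ 2 - p.total * circleMap 0 p.r₁ θ + p.lam₁ =
      -p.circleCoeff θ * circleMap 0 p.r₁ θ := by
  have h1 := circleMap_mul_circleMap_neg p.r₁ θ
  have h2 := circleMap_add_circleMap_neg p.r₁ θ
  have h3 : (p.mu₁ * p.c₁ * p.r₁ ^ 2 : ℂ) = p.lam₁ := by exact_mod_cast a_mul_r₁_sq (p := p)
  simp only [circleCoeff, Complex.ofReal_sub, Complex.ofReal_mul, Complex.ofReal_ofNat]
  linear_combination (p.mu₁ * p.c₁ : ℂ) * circleMap 0 p.r₁ θ * h2 - p.mu₁ * p.c₁ * h1 - h3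

/-- `r₁` is the geometric mean of `x₂` and `x₃`, so the circle avoids both cuts. -/
theorem x₂_lt_r₁_lt_x₃ (hp : p.Stable) : p.x₂ < p.r₁ ∧ p.r₁ < p.x₃ := by
  obtain ⟨h1, h2, h3, h4⟩ := x_order hp
  obtain ⟨-, -, -, g4⟩ := root_facts a_pos p.lam₁_pos (disc₂ hp)
  change _ * (p.x₂ * p.x₃) = _ at g4
  have h5 : p.x₂ * p.x₃ = p.r₁ ^ 2 :=
    mul_left_cancel₀ (a_pos (p := p)).ne' (g4.trans a_mul_r₁_sq.symm)
  have := r₁_pos (p := p)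
  constructor <;> nlinarith

theorem analyticAt_σ₂_of_norm_eq (hp : p.Stable) {z : ℂ} (hz : ‖z‖ = p.r₁) :
    AnalyticAt ℂ p.σ₂ z := by
  obtain ⟨h1, h2, h3, h4⟩ := x_order hp
  obtain ⟨h5, h6⟩ := x₂_lt_r₁_lt_x₃ hp
  have ho : IsOpen (((↑) : ℝ → ℂ) '' (Set.Icc p.x₁ p.x₂ ∪ Set.Icc p.x₃ p.x₄))ᶜ :=
    (((isCompact_Icc.union isCompact_Icc).image Complex.continuous_ofReal).isClosed).isOpen_compl
  refine DifferentiableOn.analyticAt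
    (fun x hx => (differentiableAt_σ₂ hp hx).differentiableWithinAt) (ho.mem_nhds ?_)
  rintro ⟨x, hx, rfl⟩
  rw [Complex.norm_real, Real.norm_eq_abs] at hz
  rcases hx with ⟨g1, g2⟩ | ⟨g1, g2⟩ <;> rw [abs_of_pos (by linarith)] at hz <;> linarith

theorem cutSqrt_of_lt {a b x : ℝ} (hab : a < b) (hx : b < x) :
    ∃ t : ℝ, 0 < t ∧ cutSqrt a b x = t := by
  have h1 : 0 < x - b := by linarith
  have h2 : 0 < (x - a) / (x - b) := div_pos (by linarith) h1
  refine ⟨(x - b) * √((x - a) / (x - b)), mul_pos h1 (Real.sqrt_pos.mpr h2), ?_⟩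
  rw [cutSqrt, Real.sqrt_eq_rpow, one_div, Complex.ofReal_mul, Complex.ofReal_cpow h2.le]
  simp [Complex.sqrt]

theorem cutSqrt_of_gt {a b x : ℝ} (hab : a < b) (hx : x < a) :
    ∃ t : ℝ, 0 < t ∧ cutSqrt a b x = -t := by
  have h1 : 0 < b - x := by linarith
  have h2 : 0 < (x - a) / (x - b) := div_pos_of_neg_of_neg (by linarith) (by linarith)
  refine ⟨(b - x) * √((x - a) / (x - b)), mul_pos h1 (Real.sqrt_pos.mpr h2), ?_⟩
  rw [cutSqrt, Real.sqrt_eq_rpow, one_div, Complex.ofReal_mul, Complex.ofReal_cpow h2.le]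
  simp [Complex.sqrt]
  ring

/-- `σ₂(x) / x` is continuous along the circle and its square is real and positive, so its sign is
constant and may be read off at `x = r₁`. The minus sign selects the smaller root for `Y₀`. -/
theorem σ₂_circleMap (hp : p.Stable) (θ : ℝ) :
    p.σ₂ (circleMap 0 p.r₁ θ) = -(√(p.circleCoeff θ ^ 2 - 4 * (p.mu₂ * p.c₂) * p.lam₂) : ℝ) *
      circleMap 0 p.r₁ θ := by
  have hr := r₁_pos (p := p)
  have hc0 : ∀ θ, circleMap 0 p.r₁ θ ≠ 0 := fun θ => circleMap_ne_center hr.ne'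
  have hnorm : ∀ θ, ‖circleMap 0 p.r₁ θ‖ = p.r₁ := fun θ => by
    rw [norm_circleMap_zero, abs_of_pos hr]
  set w : ℝ → ℝ := fun θ => √(p.circleCoeff θ ^ 2 - 4 * (p.mu₂ * p.c₂) * p.lam₂) with hw
  have hw0 : ∀ θ, 0 < w θ := fun θ => Real.sqrt_pos.mpr (circleCoeff_disc_pos hp θ)
  have hwc : Continuous w := by
    have := continuous_circleCoeff (p := p)
    fun_prop
  have hf : Continuous fun θ => p.σ₂ (circleMap 0 p.r₁ θ) / circleMap 0 p.r₁ θ := by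
    refine Continuous.div ?_ (continuous_circleMap _ _) hc0
    exact continuous_iff_continuousAt.mpr fun θ => ContinuousAt.comp (g := p.σ₂)
      (analyticAt_σ₂_of_norm_eq hp (hnorm θ)).continuousAt
      (continuous_circleMap _ _).continuousAt
  have hsq : ∀ θ, (p.σ₂ (circleMap 0 p.r₁ θ) / circleMap 0 p.r₁ θ) ^ 2 = (-(w θ : ℂ)) ^ 2 := by
    intro θ
    have h1 : (w θ : ℂ) ^ 2 = p.circleCoeff θ ^ 2 - 4 * (p.mu₂ * p.c₂) * p.lam₂ := by
      exact_mod_cast Real.sq_sqrt (circleCoeff_disc_pos hp θ).le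
    rw [div_pow, σ₂_sq hp, Δ₂, circle_quadratic, div_eq_iff (pow_ne_zero 2 (hc0 θ)), neg_sq, h1]
    ring
  -- At `r₁`, to the right of one cut and to the left of the other, the two factors of `σ₂` have
  -- opposite signs.
  have hzero : p.σ₂ (circleMap 0 p.r₁ 0) / circleMap 0 p.r₁ 0 = -(w 0 : ℂ) := by
    obtain ⟨-, h2, -, h4⟩ := x_order hp
    obtain ⟨h5, h6⟩ := x₂_lt_r₁_lt_x₃ hp
    obtain ⟨t, ht, hte⟩ := cutSqrt_of_lt h2 h5
    obtain ⟨u, hu, hue⟩ := cutSqrt_of_gt h4 h6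
    have e : p.σ₂ (circleMap 0 p.r₁ 0) / circleMap 0 p.r₁ 0 =
        ((-(p.mu₁ * p.c₁ * (t * u)) / p.r₁ : ℝ) : ℂ) := by
      have : circleMap 0 p.r₁ 0 = p.r₁ := by simp [circleMap]
      rw [this, σ₂, hte, hue]
      push_cast
      ring
    rcases sq_eq_sq_iff_eq_or_eq_neg.mp (hsq 0) with h | h
    · exact h
    · exfalso
      rw [e, neg_neg] at h
      have h' : -(p.mu₁ * p.c₁ * (t * u)) / p.r₁ = w 0 := by exact_mod_cast h
      have : -(p.mu₁ * p.c₁ * (t * u)) / p.r₁ < 0 :=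
        div_neg_of_neg_of_pos (neg_neg_of_pos (mul_pos a_pos (mul_pos ht hu))) hr
      linarith [hw0 0]
  have := isPreconnected_univ.eq_of_sq_eq (f := fun θ => p.σ₂ (circleMap 0 p.r₁ θ) /
    circleMap 0 p.r₁ θ) (g := fun θ => -(w θ : ℂ)) hf.continuousOn
    (Complex.continuous_ofReal.comp hwc).neg.continuousOn (fun θ _ => hsq θ)
    (fun {θ} _ => neg_ne_zero.mpr (by exact_mod_cast (hw0 θ).ne')) (Set.mem_univ 0) hzero
    (Set.mem_univ θ)
  exact (div_eq_iff (hc0 θ)).mp this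

theorem Y₀_circleMap (hp : p.Stable) (θ : ℝ) :
    p.Y₀ (circleMap 0 p.r₁ θ) = p.circleRoot θ := by
  have hc0 : circleMap 0 p.r₁ θ ≠ 0 := circleMap_ne_center r₁_pos.ne'
  rw [Y₀, σ₂_circleMap hp, circle_quadratic, circleRoot, smallRoot]
  have h2 : (p.mu₂ : ℂ) ≠ 0 := by exact_mod_cast p.mu₂_pos.ne'
  have h3 : (p.c₂ : ℂ) ≠ 0 := by exact_mod_cast p.c₂_pos.ne'
  push_cast
  field_simp
  ring

/-! ### The logarithm of the coefficient -/

variable (p) in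
/-- A logarithm of `α₁`, analytic near the circle `|x| = r₁`, where `conj x = λ₁ / (μ₁ c₁ x)`. -/
noncomputable def logα₁ (x : ℂ) : ℂ :=
  Complex.log (1 - p.Y₀ x / x) - Complex.log (1 - p.Y₀ x * x / p.r₁ ^ 2)

theorem one_sub_Y₀_div (hp : p.Stable) (θ : ℝ) :
    1 - p.Y₀ (circleMap 0 p.r₁ θ) / circleMap 0 p.r₁ θ =
      ⟨(p.r₁ - p.circleRoot θ * Real.cos θ) / p.r₁, p.circleRoot θ * Real.sin θ / p.r₁⟩ := by
  have hc0 : circleMap 0 p.r₁ θ ≠ 0 := circleMap_ne_center r₁_pos.ne'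
  have hr : (p.r₁ : ℂ) ≠ 0 := by exact_mod_cast r₁_pos.ne'
  have h1 := circleMap_mul_circleMap_neg p.r₁ θ
  have h2 : p.Y₀ (circleMap 0 p.r₁ θ) / circleMap 0 p.r₁ θ =
      p.circleRoot θ * circleMap 0 p.r₁ (-θ) / p.r₁ ^ 2 := by
    rw [Y₀_circleMap hp, div_eq_div_iff hc0 (pow_ne_zero 2 hr), ← h1]
    ring
  rw [h2, circleMap_neg_eq, Complex.mk_eq_add_mul_I]
  push_cast
  field_simp
  ring

/-- `Y₀` is real on the circle and `x / r₁² = 1 / conj x`; the left side is the version analytic in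
`x`. -/
theorem one_sub_Y₀_mul (hp : p.Stable) (θ : ℝ) :
    1 - p.Y₀ (circleMap 0 p.r₁ θ) * circleMap 0 p.r₁ θ / p.r₁ ^ 2 = starRingEnd ℂ
      (1 - p.Y₀ (circleMap 0 p.r₁ θ) / circleMap 0 p.r₁ θ) := by
  have hc0 : circleMap 0 p.r₁ θ ≠ 0 := circleMap_ne_center r₁_pos.ne'
  have hc0' : circleMap 0 p.r₁ (-θ) ≠ 0 := circleMap_ne_center r₁_pos.ne'
  have h1 := circleMap_mul_circleMap_neg p.r₁ θ
  rw [map_sub, map_one, map_div₀, conj_circleMap, Y₀_circleMap hp, Complex.conj_ofReal, ← h1]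
  field_simp

theorem one_sub_Y₀_div_re_pos (hp : p.Stable) (θ : ℝ) :
    0 < (1 - p.Y₀ (circleMap 0 p.r₁ θ) / circleMap 0 p.r₁ θ).re := by
  rw [one_sub_Y₀_div hp]
  exact div_pos (r₁_sub_circleRoot_pos hp θ) r₁_pos

theorem analyticAt_logα₁ (hp : p.Stable) {z : ℂ} (hz : ‖z‖ = p.r₁) :
    AnalyticAt ℂ p.logα₁ z := by
  obtain ⟨θ, rfl⟩ := exists_circleMap_eq r₁_pos hz
  have hc0 : circleMap 0 p.r₁ θ ≠ 0 := circleMap_ne_center r₁_pos.ne'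
  have hσ := analyticAt_σ₂_of_norm_eq hp hz
  have hb : (2 * (p.mu₂ * p.c₂) : ℂ) ≠ 0 := by
    exact_mod_cast (mul_pos two_pos (b_pos (p := p))).ne'
  have hr : (p.r₁ : ℂ) ^ 2 ≠ 0 := by exact_mod_cast (pow_pos (r₁_pos (p := p)) 2).ne'
  have hY : AnalyticAt ℂ p.Y₀ (circleMap 0 p.r₁ θ) := by
    unfold Y₀
    fun_prop (disch := exact mul_ne_zero hb hc0)
  have h1 := one_sub_Y₀_div_re_pos hp θ
  refine AnalyticAt.sub (AnalyticAt.clog (by fun_prop (disch := exact hc0)) (Or.inl h1))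
    (AnalyticAt.clog (by fun_prop (disch := exact hr)) (Or.inl ?_))
  rw [one_sub_Y₀_mul hp, Complex.conj_re]
  exact h1

theorem α₁_eq_exp (hp : p.Stable) {z : ℂ} (hz : ‖z‖ = p.r₁) :
    p.α₁ z = Complex.exp (p.logα₁ z) := by
  obtain ⟨θ, rfl⟩ := exists_circleMap_eq r₁_pos hz
  have hc0 : circleMap 0 p.r₁ θ ≠ 0 := circleMap_ne_center r₁_pos.ne'
  have hc0' : circleMap 0 p.r₁ (-θ) ≠ 0 := circleMap_ne_center r₁_pos.ne'
  have h1 := one_sub_Y₀_div_re_pos hp θ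
  have h0 : 1 - p.Y₀ (circleMap 0 p.r₁ θ) / circleMap 0 p.r₁ θ ≠ 0 := fun h => by
    rw [h] at h1; exact lt_irrefl _ h1
  have h0' := (map_ne_zero (starRingEnd ℂ)).mpr h0
  rw [logα₁, Complex.exp_sub, one_sub_Y₀_mul hp, Complex.exp_log h0, Complex.exp_log h0', α₁]
  rw [map_sub, map_one, map_div₀, conj_circleMap, Y₀_circleMap hp, Complex.conj_ofReal] at *
  have h2 : 1 - (p.circleRoot θ : ℂ) / circleMap 0 p.r₁ (-θ) =
      -(p.circleRoot θ - circleMap 0 p.r₁ (-θ)) / circleMap 0 p.r₁ (-θ) := by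
    field_simp; ring
  rw [h2] at h0' ⊢
  have h3 : (p.circleRoot θ - circleMap 0 p.r₁ (-θ) : ℂ) ≠ 0 := fun h => by simp [h] at h0'
  field_simp
  ring

variable (p) in
/-- Half the argument of `α₁(x)`, for `x = r₁ exp (i θ)`. -/
noncomputable def circleAngle (θ : ℝ) : ℝ :=
  Real.arctan (p.circleRoot θ * Real.sin θ / (p.r₁ - p.circleRoot θ * Real.cos θ))

/-- `log w - log (conj w) = 2 i arg w`, and in the right half-plane `arg w` is the arctangent of `im
w / re w`. -/
theorem logα₁_circleMap (hp : p.Stable) (θ : ℝ) :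
    p.logα₁ (circleMap 0 p.r₁ θ) = 2 * p.circleAngle θ * Complex.I := by
  have h1 := one_sub_Y₀_div_re_pos hp θ
  have harg := abs_lt.mp (Complex.abs_arg_lt_pi_div_two_iff.mpr (Or.inl h1))
  have hne : (1 - p.Y₀ (circleMap 0 p.r₁ θ) / circleMap 0 p.r₁ θ).arg ≠ Real.pi := by
    linarith [Real.pi_pos]
  rw [logα₁, one_sub_Y₀_mul hp, Complex.log_conj _ hne, Complex.sub_conj, Complex.log_im,
    ← Real.arctan_tan harg.1 harg.2, Complex.tan_arg, one_sub_Y₀_div hp, circleAngle,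
    div_div_div_cancel_right₀ r₁_pos.ne']
  push_cast
  ring

theorem circleRoot_neg (θ : ℝ) : p.circleRoot (-θ) = p.circleRoot θ := by
  simp only [circleRoot, circleCoeff, Real.cos_neg]

theorem circleAngle_neg (θ : ℝ) : p.circleAngle (-θ) = -p.circleAngle θ := by
  simp only [circleAngle, circleRoot_neg, Real.cos_neg, Real.sin_neg, mul_neg, neg_div,
    Real.arctan_neg]

theorem continuous_circleAngle (hp : p.Stable) : Continuous p.circleAngle := by
  have h := continuous_circleRoot hp
  exact Real.continuous_arctan.comp (Continuous.div (by fun_prop) (by fun_prop)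
    fun θ => (r₁_sub_circleRoot_pos hp θ).ne')

/-- Shows that the denominator in `Θ₁` is positive on `[y₁, y₂]`, so the arctangent needs no
correction by `π`. -/
theorem Θ₁_denominator (hp : p.Stable) (θ : ℝ) :
    p.mu₂ * p.c₂ * p.circleRoot θ ^ 2 - p.total * p.circleRoot θ + 2 * p.lam₁ + p.lam₂ =
      2 * (p.mu₁ * p.c₁ * p.r₁) * (p.r₁ - p.circleRoot θ * Real.cos θ) := by
  have hq := circleRoot_quadratic hp θ
  unfold circleCoeff at hq
  linear_combination hq - 2 * a_mul_r₁_sq (p := p)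

/-- `-Δ₁` becomes the square of `2 a r₁ Y₀ sin θ`, with `a = μ₁ c₁`; the nonnegative root has the
right sign only where `sin θ ≥ 0`. -/
theorem Θ₁_circleRoot (hp : p.Stable) {θ : ℝ} (hθ : θ ∈ Set.Icc 0 Real.pi) :
    p.Θ₁ (p.circleRoot θ) = p.circleAngle θ := by
  have hq := circleRoot_quadratic hp θ
  unfold circleCoeff at hq
  have ha : 0 < 2 * (p.mu₁ * p.c₁ * p.r₁) := mul_pos two_pos (mul_pos a_pos r₁_pos)
  have hd : -p.Δ₁ (p.circleRoot θ) =
      (2 * (p.mu₁ * p.c₁ * p.r₁) * (p.circleRoot θ * Real.sin θ)) ^ 2 := by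
    have hq' : p.mu₂ * p.c₂ * p.circleRoot θ ^ 2 - p.total * p.circleRoot θ + p.lam₂ =
        -(2 * (p.mu₁ * p.c₁ * p.r₁) * Real.cos θ * p.circleRoot θ) := by
      linear_combination hq
    rw [Δ₁, hq']
    linear_combination -4 * (p.mu₁ * p.c₁) * p.circleRoot θ ^ 2 * a_mul_r₁_sq (p := p) -
      4 * (p.mu₁ * p.c₁ * p.r₁) ^ 2 * p.circleRoot θ ^ 2 * Real.sin_sq_add_cos_sq θ
  rw [Θ₁, Θ₁_denominator hp, hd, Real.sqrt_sq (mul_nonneg ha.le (mul_nonneg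
    (circleRoot_pos hp θ).le (Real.sin_nonneg_of_mem_Icc hθ))), circleAngle,
    mul_div_mul_left _ _ ha.ne']

/-- Twice `circleAngle` is a continuous argument of `α₁`, and it vanishes at both ends because `sin
θ` does. -/
theorem hasIndex_α₁ (hp : p.Stable) : HasIndex p.r₁ p.α₁ 0 := by
  have hnorm : ∀ θ, ‖circleMap 0 p.r₁ θ‖ = p.r₁ := fun θ => by
    rw [norm_circleMap_zero, abs_of_pos r₁_pos]
  have hexp : ∀ θ, p.α₁ (circleMap 0 p.r₁ θ) =
      Complex.exp ((2 * p.circleAngle θ : ℝ) * Complex.I) := fun θ => by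
    rw [α₁_eq_exp hp (hnorm θ), logα₁_circleMap hp]
    push_cast
    rfl
  refine ⟨fun θ => 2 * p.circleAngle θ, ((continuous_circleAngle hp).const_mul 2).continuousOn,
    fun t _ => ⟨?_, ?_⟩, ?_⟩
  · rw [hexp]
    exact Complex.exp_ne_zero _
  · rw [hexp, Complex.norm_exp_ofReal_mul_I, Complex.ofReal_one, one_mul]
  · simp [circleAngle, circleRoot, circleCoeff]

/-! ### The Cauchy integral as an integral over `[y₁, y₂]` -/

theorem circle_sub_ne_zero {x : ℂ} (hx : ‖x‖ < p.r₁) (θ : ℝ) : circleMap 0 p.r₁ θ - x ≠ 0 := by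
  intro h
  rw [← sub_eq_zero.mp h, norm_circleMap_zero, abs_of_pos r₁_pos] at hx
  exact lt_irrefl _ hx

/-- For this value of `y`, the two roots of `K(·, y)` are conjugate points of the circle; hence `K`
does not vanish for `x` inside. -/
theorem K_circleRoot (hp : p.Stable) (x : ℂ) (θ : ℝ) :
    p.K x (p.circleRoot θ) = p.mu₁ * p.c₁ * p.circleRoot θ *
      ((circleMap 0 p.r₁ θ - x) * (circleMap 0 p.r₁ (-θ) - x)) := by
  have h1 := circleMap_mul_circleMap_neg p.r₁ θ
  have h2 := circleMap_add_circleMap_neg p.r₁ θ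
  have h3 : (p.mu₁ * p.c₁ * p.r₁ ^ 2 : ℂ) = p.lam₁ := by exact_mod_cast a_mul_r₁_sq (p := p)
  have hq : (p.mu₂ * p.c₂ * p.circleRoot θ ^ 2 - (p.total - 2 * (p.mu₁ * p.c₁ * p.r₁) *
      Real.cos θ) * p.circleRoot θ + p.lam₂ : ℂ) = 0 := by
    exact_mod_cast circleRoot_quadratic hp θ
  unfold K
  linear_combination x * hq - p.circleRoot θ * h3 - p.mu₁ * p.c₁ * p.circleRoot θ * h1 +
    p.mu₁ * p.c₁ * p.circleRoot θ * x * h2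

theorem K_ne_zero (hp : p.Stable) {x : ℂ} (hx : ‖x‖ < p.r₁) {y : ℝ}
    (hy : y ∈ Set.Icc p.y₁ p.y₂) : p.K x y ≠ 0 := by
  obtain ⟨θ, rfl⟩ := exists_circleRoot_eq hp hy
  rw [K_circleRoot hp]
  have h : (p.mu₁ * p.c₁ * p.circleRoot θ : ℂ) ≠ 0 := by
    exact_mod_cast (mul_pos a_pos (circleRoot_pos hp θ)).ne'
  exact mul_ne_zero h (mul_ne_zero (circle_sub_ne_zero hx θ) (circle_sub_ne_zero hx (-θ)))

theorem continuousOn_integrand (hp : p.Stable) {x : ℂ} (hx : ‖x‖ < p.r₁) :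
    ContinuousOn (p.integrand x) (Set.Icc p.y₁ p.y₂) := by
  have hΔ : Continuous p.Δ₁ := by unfold Δ₁; fun_prop
  have hΘ : ContinuousOn p.Θ₁ (Set.Icc p.y₁ p.y₂) := by
    refine Real.continuous_arctan.comp_continuousOn (ContinuousOn.div (by fun_prop)
      (by fun_prop) fun y hy => ?_)
    obtain ⟨θ, rfl⟩ := exists_circleRoot_eq hp hy
    rw [Θ₁_denominator hp]
    exact (mul_pos (mul_pos two_pos (mul_pos a_pos r₁_pos)) (r₁_sub_circleRoot_pos hp θ)).ne'
  refine ContinuousOn.div ?_ ?_ fun y hy => mul_ne_zero ?_ (K_ne_zero hp hx hy)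
  · exact Complex.continuous_ofReal.comp_continuousOn (ContinuousOn.mul (by fun_prop) hΘ)
  · unfold K
    fun_prop
  · exact_mod_cast ((y_order hp).1.trans_le hy.1).ne'

theorem intervalIntegrable_integrand (hp : p.Stable) {x : ℂ} (hx : ‖x‖ < p.r₁) :
    IntervalIntegrable (p.integrand x) MeasureTheory.volume p.y₁ p.y₂ := by
  refine ContinuousOn.intervalIntegrable ?_
  rw [Set.uIcc_of_le (y_order hp).2.1.le]
  exact continuousOn_integrand hp hx

theorem integral_integrand (hp : p.Stable) {x : ℂ} (hx : ‖x‖ < p.r₁) :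
    ∫ y in p.y₁..p.y₂, p.integrand x y = ∫ θ in (0 : ℝ)..Real.pi,
      2 * p.circleAngle θ * (p.r₁ * Real.sin θ) /
        ((circleMap 0 p.r₁ θ - x) * (circleMap 0 p.r₁ (-θ) - x)) := by
  have hc := continuous_circleRoot hp
  have h := intervalIntegral.integral_deriv_smul_comp' (a := 0) (b := Real.pi)
    (fun θ _ => hasDerivAt_circleRoot hp θ) (Continuous.continuousOn (Continuous.div
      (by fun_prop) (by fun_prop) fun θ => (sub_pos.mpr (circleRoot_sq_lt hp θ)).ne'))
    (g := p.integrand x) ((continuousOn_integrand hp hx).mono (by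
      rintro _ ⟨θ, -, rfl⟩
      exact circleRoot_mem_Icc hp θ))
  rw [circleRoot_zero, circleRoot_pi] at h
  -- As `θ` goes from `0` to `π`, `y` goes from `y₂` back to `y₁`, hence the change of sign.
  rw [intervalIntegral.integral_symm, ← h, ← intervalIntegral.integral_neg]
  refine intervalIntegral.integral_congr fun θ hθ => ?_
  rw [Set.uIcc_of_le Real.pi_pos.le] at hθ
  have hY : (p.circleRoot θ : ℂ) ≠ 0 := by exact_mod_cast (circleRoot_pos hp θ).ne'
  have ha1 : (p.mu₁ : ℂ) ≠ 0 := by exact_mod_cast p.mu₁_pos.ne'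
  have ha2 : (p.c₁ : ℂ) ≠ 0 := by exact_mod_cast p.c₁_pos.ne'
  have hb : (p.lam₂ - p.mu₂ * p.c₂ * p.circleRoot θ ^ 2 : ℂ) ≠ 0 := by
    exact_mod_cast (sub_pos.mpr (circleRoot_sq_lt hp θ)).ne'
  have h1 := circle_sub_ne_zero hx θ
  have h2 := circle_sub_ne_zero hx (-θ)
  simp only [Function.comp_apply, integrand, Θ₁_circleRoot hp hθ, K_circleRoot hp,
    Complex.real_smul]
  push_cast
  generalize circleMap 0 p.r₁ θ - x = u at *
  generalize circleMap 0 p.r₁ (-θ) - x = v at *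
  generalize (p.lam₂ - p.mu₂ * p.c₂ * p.circleRoot θ ^ 2 : ℂ) = e at *
  field_simp

/-- With `c`, `d` the points at `θ` and `-θ`, oddness of the angle leaves `c / (c - x) - d / (d - x)
= -x (c - d) / ((c - x) (d - x))`, which produces the factor `x` and, from `c - d`, the factor `sin
θ` of the substitution. -/
theorem cauchyIntegral_logα₁ (hp : p.Stable) {x : ℂ} (hx : ‖x‖ < p.r₁) :
    (2 * Real.pi * Complex.I : ℂ)⁻¹ • (∮ t in C(0, p.r₁), (t - x)⁻¹ • p.logα₁ t) =
      x / Real.pi * ∫ y in p.y₁..p.y₂, p.integrand x y := by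
  set G : ℝ → ℂ := fun θ => deriv (circleMap 0 p.r₁) θ • (circleMap 0 p.r₁ θ - x)⁻¹ •
    p.logα₁ (circleMap 0 p.r₁ θ) with hG
  have hper : Function.Periodic G (2 * Real.pi) := fun θ => by
    simp only [hG, deriv_circleMap, periodic_circleMap (0 : ℂ) p.r₁ θ]
  have hGe : ∀ θ, G θ = -2 * circleMap 0 p.r₁ θ * p.circleAngle θ /
      (circleMap 0 p.r₁ θ - x) := fun θ => by
    simp only [hG, deriv_circleMap, logα₁_circleMap hp, smul_eq_mul]
    linear_combination 2 * circleMap 0 p.r₁ θ * p.circleAngle θ *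
      (circleMap 0 p.r₁ θ - x)⁻¹ * Complex.I_sq
  have hGc : Continuous G := by
    rw [funext hGe]
    have := continuous_circleAngle hp
    exact Continuous.div (by fun_prop) (by fun_prop) (circle_sub_ne_zero hx)
  have h1 : (∮ t in C(0, p.r₁), (t - x)⁻¹ • p.logα₁ t) =
      ∫ θ in (0 : ℝ)..Real.pi, (G (-θ) + G θ) := by
    -- The period is moved to `[-π, π]` so that its two halves can be folded together.
    have e1 := hper.intervalIntegral_add_eq 0 (-Real.pi)
    rw [zero_add, show -Real.pi + 2 * Real.pi = Real.pi by ring,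
      ← intervalIntegral.integral_add_adjacent_intervals (a := -Real.pi) (b := 0)
        (hGc.intervalIntegrable _ _) (hGc.intervalIntegrable _ _)] at e1
    have hGn : Continuous fun θ => G (-θ) := hGc.comp continuous_neg
    rw [intervalIntegral.integral_add (hGn.intervalIntegrable _ _) (hGc.intervalIntegrable _ _),
      intervalIntegral.integral_comp_neg, neg_zero]
    exact e1
  rw [h1, integral_integrand hp hx, ← intervalIntegral.integral_const_mul, smul_eq_mul,
    ← intervalIntegral.integral_const_mul]
  refine intervalIntegral.integral_congr fun θ _ => ?_
  have hu := circle_sub_ne_zero hx θ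
  have hv := circle_sub_ne_zero hx (-θ)
  have hpi : (Real.pi : ℂ) ≠ 0 := by exact_mod_cast Real.pi_ne_zero
  have hd : circleMap 0 p.r₁ θ - circleMap 0 p.r₁ (-θ) = 2 * Complex.I * p.r₁ * Real.sin θ := by
    rw [circleMap_eq, circleMap_neg_eq]
    ring
  simp only [hGe, circleAngle_neg, Complex.ofReal_neg]
  have hI := Complex.I_ne_zero
  generalize circleMap 0 p.r₁ θ = c at *
  generalize circleMap 0 p.r₁ (-θ) = d at *
  field_simp
  linear_combination x * p.circleAngle θ * hd

end WalkParams

theorem mainTheorem5 (p : WalkParams) (hp : p.Stable) :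
    HasIndex p.r₁ p.α₁ 0 ∧
    (∃ φ₁ : ℂ → ℂ, SolvesHomogeneousRH p.r₁ p.α₁ φ₁ ∧
      Tendsto φ₁ (Bornology.cobounded ℂ) (𝓝 1)) ∧
    (∀ x : ℂ, ‖x‖ < p.r₁ →
      IntervalIntegrable (p.integrand x) MeasureTheory.volume p.y₁ p.y₂) ∧
    (∀ (φ₁ : ℂ → ℂ) (C : ℂ), SolvesHomogeneousRH p.r₁ p.α₁ φ₁ →
      Tendsto φ₁ (Bornology.cobounded ℂ) (𝓝 C) →
      ∀ x : ℂ, ‖x‖ < p.r₁ →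
        φ₁ x = C * Complex.exp (x / Real.pi * ∫ y in p.y₁..p.y₂, p.integrand x y)) := by
  obtain ⟨h1, h2⟩ := homogeneousRH_of_eq_exp WalkParams.r₁_pos
    (fun _ => WalkParams.analyticAt_logα₁ hp) (fun _ => WalkParams.α₁_eq_exp hp)
  refine ⟨WalkParams.hasIndex_α₁ hp, h1,
    fun x hx => WalkParams.intervalIntegrable_integrand hp hx, fun φ₁ C hφ hC x hx => ?_⟩
  rw [h2 φ₁ C hφ hC x hx, WalkParams.cauchyIntegral_logα₁ hp hx]
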